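/- Let $L$ be a nonzero complex number. For $g_2,g_3\in\mathbb C$ with $g_2^3-27g_3^2\neq 0$, let $\wp(z)=\wp(z;g_2,g_3)$ denote the Weierstrass elliptic function with invariants $g_2,g_3$, so that $\wp'^2=4\wp^3-g_2\wp-g_3$. For an equation $(u')^k=R(u)$ with $R$ a polynomial, say that a family $(\varphi_{z_0})_{z_0\in\mathbb C}$ of meromorphic functions on $\mathbb C$ is its general solution if, on every nonempty connected open set $U\subseteq\mathbb C$, the nonconstant meromorphic solutions are exactly the restrictions to $U$ of the functions $\varphi_{z_0}$, $z_0\in\mathbb C$. Then: (i) There is a period lattice with invariants $g_2=0$, $g_3=-\frac{4L^6}{729}$, and for the corresponding $\wp$ the general solution of $$\left(\frac{du}{dz}\right)^3=L^3u^2(u-1)^2(u+1)^2$$ is $$u(z)=-\frac{2L^3}{27\,\wp'(z-z_0)},\qquad z_0\in\mathbb C \text{ arbitrary}.$$ (ii) There is a period lattice with invariants $g_2=-\frac{L^4}{16}$, $g_3=0$, and for the corresponding $\wp$ the general solution of $$\left(\frac{du}{dz}\right)^4=L^4u^2(u-1)^3(u+1)^3$$ is $$u(z)=1+\frac{L^4}{32\left(\wp^2(z-z_0)-\frac{L^4}{64}\right)},\qquad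 z_0\in\mathbb C \text{ arbitrary}.$$ -/

import Mathlib

open Filter

/-- `u` is a meromorphic solution on `U` of the autonomous binomial equation `(u')^k = R(u)`:
`u` is meromorphic on `U` and satisfies the equation at every point of `U` where it is analytic
(that is, away from its poles and from the isolated points where it carries no proper value). -/
def IsMeromorphicSolutionOn (k : ℕ) (R : ℂ → ℂ) (U : Set ℂ) (u : ℂ → ℂ) : Prop :=
  MeromorphicOn u U ∧ ∀ z ∈ U, AnalyticAt ℂ u z → deriv u z ^ k = R (u z)

/-- `u` and `v` define the same meromorphic function on `U`: they agree on `U` outside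
a set without accumulation point in `U`. -/
def SameMeromorphicOn (U : Set ℂ) (u v : ℂ → ℂ) : Prop :=
  u =ᶠ[codiscreteWithin U] v

/-- The one-parameter family `φ z₀`, with `z₀ : ℂ` arbitrary, is the general solution of
`(u')^k = R(u)`: on every domain `U` of the complex plane, the nonconstant meromorphic solutions
are exactly the (restrictions to `U` of the) members of the family. -/
def IsGeneralSolution (k : ℕ) (R : ℂ → ℂ) (φ : ℂ → ℂ → ℂ) : Prop :=
  ∀ U : Set ℂ, IsOpen U → IsConnected U → ∀ u : ℂ → ℂ,
    (IsMeromorphicSolutionOn k R U u ∧ ¬ ∃ c : ℂ, SameMeromorphicOn U u (fun _ => c)) ↔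
      ∃ z₀ : ℂ, SameMeromorphicOn U u (φ z₀)

open scoped Topology

/-! The equation is autonomous, so everything reduces to finding one solution `φ` that attains every
point `(b, c)` of the curve `c ^ k = R b` with `R b ≠ 0` as `(φ p, φ' p)`. A nonconstant solution
`u` has a regular point; matching both value and derivative there fixes the branch of the `k`-th
root, so `u` is locally a translate of `φ`, and the identity theorem extends this to the whole
domain (`isGeneralSolution_of_transitive`). For the two equations the curve is parametrized
rationally by the cubic `y ^ 2 = 4 * x ^ 3 - g₂ * x - g₃`, whose affine points are all of the form
`(℘, ℘')` by Liouville's theorem. The lattices are rescaled hexagonal and square ones: symmetry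
kills one invariant, so the other is nonzero. -/

/-! ### Identity theorem for meromorphic functions -/

theorem AnalyticAt.eventually_eq_of_deriv_eventually_eq_zero {f : ℂ → ℂ} {z : ℂ}
    (hf : AnalyticAt ℂ f z) (h : ∀ᶠ y in 𝓝 z, deriv f y = 0) : ∀ᶠ y in 𝓝 z, f y = f z := by
  obtain ⟨r, hr, hball⟩ := Metric.eventually_nhds_iff_ball.1 (hf.eventually_analyticAt.and h)
  filter_upwards [Metric.ball_mem_nhds z hr] with y hy
  exact Metric.isOpen_ball.is_const_of_deriv_eq_zero (convex_ball z r).isPreconnected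
    (fun x hx => (hball x hx).1.differentiableAt.differentiableWithinAt)
    (fun x hx => (hball x hx).2) hy (Metric.mem_ball_self hr)

theorem sameMeromorphicOn_of_eventuallyEq {U : Set ℂ} {u v : ℂ → ℂ} (hU : IsPreconnected U)
    (hu : MeromorphicOn u U) (hv : MeromorphicOn v U) {z : ℂ} (hz : z ∈ U)
    (h : u =ᶠ[𝓝[≠] z] v) : SameMeromorphicOn U u v := by
  have hf : MeromorphicOn (u - v) U := hu.sub hv
  have hz' : meromorphicOrderAt (u - v) z = ⊤ := by
    rw [meromorphicOrderAt_eq_top_iff]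
    filter_upwards [h] with y hy
    simp [hy]
  refine mem_codiscreteWithin_iff_forall_mem_nhdsNE.2 fun x hx => ?_
  have hx' : meromorphicOrderAt (u - v) x = ⊤ := by
    by_contra hne
    exact hf.meromorphicOrderAt_ne_top_of_isPreconnected hU hx hz hne hz'
  rw [meromorphicOrderAt_eq_top_iff] at hx'
  filter_upwards [hx'] with y hy
  exact Or.inl (sub_eq_zero.1 hy)

theorem SameMeromorphicOn.eventuallyEq {U : Set ℂ} {u v : ℂ → ℂ} (h : SameMeromorphicOn U u v)
    (hU : IsOpen U) {z : ℂ} (hz : z ∈ U) : u =ᶠ[𝓝[≠] z] v := by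
  filter_upwards [mem_codiscreteWithin_iff_forall_mem_nhdsNE.1 h z hz,
    nhdsWithin_le_nhds (hU.mem_nhds hz)] with y hy hyU
  exact hy.resolve_right fun h => h hyU

/-! ### Autonomous equations: local uniqueness and the general solution -/

/-- An autonomous equation that holds near a point holds at the point itself. -/
theorem AnalyticAt.deriv_pow_eq_of_eventually {k : ℕ} {R u : ℂ → ℂ} (hR : Continuous R) {z : ℂ}
    (hu : AnalyticAt ℂ u z) (h : ∀ᶠ y in 𝓝[≠] z, deriv u y ^ k = R (u y)) :
    deriv u z ^ k = R (u z) := by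
  have h₁ : Tendsto (fun y => deriv u y ^ k) (𝓝[≠] z) (𝓝 (deriv u z ^ k)) :=
    (hu.deriv.continuousAt.pow k).tendsto.mono_left nhdsWithin_le_nhds
  have h₂ : Tendsto (fun y => R (u y)) (𝓝[≠] z) (𝓝 (R (u z))) :=
    (hR.continuousAt.comp hu.continuousAt).tendsto.mono_left nhdsWithin_le_nhds
  exact tendsto_nhds_unique h₁ (h₂.congr' (h.mono fun y hy => hy.symm))

theorem eventually_deriv_pow_eq {k : ℕ} {R u : ℂ → ℂ} (hR : Continuous R) {z : ℂ}
    (hu : AnalyticAt ℂ u z) (h : ∀ᶠ y in 𝓝[≠] z, deriv u y ^ k = R (u y)) :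
    ∀ᶠ y in 𝓝 z, deriv u y ^ k = R (u y) := by
  rw [eventually_nhdsWithin_iff] at h
  filter_upwards [h] with y hy
  by_cases hyz : y = z
  · rw [hyz]
    exact hu.deriv_pow_eq_of_eventually hR (eventually_nhdsWithin_iff.2 h)
  · exact hy hyz

/-- A continuous function with `k`-th power one that takes the value one is locally one. -/
theorem ContinuousAt.eventually_eq_one_of_pow {k : ℕ} (hk : k ≠ 0) {g : ℂ → ℂ} {z : ℂ}
    (hg : ContinuousAt g z) (hz : g z = 1) (h : ∀ᶠ y in 𝓝 z, g y ^ k = 1) :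
    ∀ᶠ y in 𝓝 z, g y = 1 := by
  -- The cofactor of `g - 1` in `g ^ k - 1` equals `k ≠ 0` at `z`, hence stays nonzero nearby.
  have hs : ContinuousAt (fun y => ∑ i ∈ Finset.range k, g y ^ i) z := by fun_prop
  have hne : (∑ i ∈ Finset.range k, g z ^ i) ≠ 0 := by simp [hz, hk]
  filter_upwards [h, hs.eventually_ne hne] with y hy hy'
  have := mul_geom_sum (g y) k
  rw [hy, sub_self] at this
  exact sub_eq_zero.1 ((mul_eq_zero.1 this).resolve_right (by simpa using hy'))

/-- Two local solutions of `(u')^k = R(u)` with the same regular initial data are translates of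
each other. -/
theorem eventuallyEq_translate_of_deriv_pow_eq {k : ℕ} (hk : k ≠ 0) {R u φ : ℂ → ℂ}
    {z p : ℂ} (hu : AnalyticAt ℂ u z) (hφ : AnalyticAt ℂ φ p)
    (hval : φ p = u z) (hder : deriv φ p = deriv u z) (hne : deriv u z ≠ 0)
    (huode : ∀ᶠ y in 𝓝 z, deriv u y ^ k = R (u y))
    (hφode : ∀ᶠ y in 𝓝 p, deriv φ y ^ k = R (φ y)) :
    ∀ᶠ y in 𝓝 z, u y = φ (y - (z - p)) := by
  have hφ' : deriv φ p ≠ 0 := hder ▸ hne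
  set ψ := hφ.hasStrictDerivAt.localInverse _ _ _ hφ' with hψdef
  have hψ : AnalyticAt ℂ ψ (u z) := hval ▸ hφ.analyticAt_localInverse hφ'
  have hψp : ψ (u z) = p := by
    rw [← hval]
    exact (hφ.hasStrictDerivAt.eventually_left_inverse hφ').self_of_nhds
  have hinv : ∀ᶠ y in 𝓝 (u z), φ (ψ y) = y :=
    hval ▸ hφ.hasStrictDerivAt.eventually_right_inverse hφ'
  -- With `u = φ ∘ h`, both equations give `h' ^ k = 1`; since `h' z = 1`, `h` is a translation.
  set h : ℂ → ℂ := fun y => ψ (u y) with hh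
  have hhz : h z = p := hψp
  have han : AnalyticAt ℂ h z := hψ.comp hu
  have hφh : ∀ᶠ y in 𝓝 z, φ (h y) = u y := hu.continuousAt.eventually hinv
  have hcont : Tendsto h (𝓝 z) (𝓝 p) := hhz ▸ han.continuousAt.tendsto
  have hchain : ∀ᶠ y in 𝓝 z, deriv u y = deriv φ (h y) * deriv h y := by
    filter_upwards [hφh.eventually_nhds, hcont.eventually hφ.eventually_analyticAt,
      han.eventually_analyticAt] with y hy h₁ h₂
    have hy' : (fun x => φ (h x)) =ᶠ[𝓝 y] u := hy
    rw [← hy'.deriv_eq]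
    exact (h₁.differentiableAt.hasDerivAt.comp y h₂.differentiableAt.hasDerivAt).deriv
  have hone : deriv h z = 1 := by
    have := hchain.self_of_nhds
    rw [hhz, hder] at this
    exact mul_left_cancel₀ hne (by rw [← this, mul_one])
  have hpow : ∀ᶠ y in 𝓝 z, deriv h y ^ k = 1 := by
    filter_upwards [hchain, huode, hcont.eventually hφode, hφh,
      hu.deriv.continuousAt.eventually_ne hne] with y h₁ h₂ h₃ h₄ h₅
    have h₆ : deriv u y ^ k ≠ 0 := pow_ne_zero k h₅
    have h₇ : deriv φ (h y) ^ k = deriv u y ^ k := by rw [h₃, h₄, h₂]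
    have h₈ : deriv u y ^ k = deriv u y ^ k * deriv h y ^ k := by
      conv_lhs => rw [h₁, mul_pow, h₇]
    exact mul_left_cancel₀ h₆ (by rw [← h₈, mul_one])
  have hd := ContinuousAt.eventually_eq_one_of_pow hk han.deriv.continuousAt hone hpow
  have htr : ∀ᶠ y in 𝓝 z, h y - y = h z - z := by
    refine (han.sub analyticAt_id).eventually_eq_of_deriv_eventually_eq_zero ?_
    filter_upwards [hd, han.eventually_analyticAt] with y h₁ h₂
    rw [deriv_sub h₂.differentiableAt differentiableAt_id, h₁, deriv_id, sub_self]
  filter_upwards [htr, hφh] with y h₁ h₂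
  rw [← h₂, show y - (z - p) = h y by rw [hhz] at h₁; linear_combination -h₁]

/-- A meromorphic solution attaining every regular initial condition yields, by translation, the
general solution. -/
theorem isGeneralSolution_of_transitive {k : ℕ} (hk : k ≠ 0) {R φ : ℂ → ℂ} (hR : Continuous R)
    (hRne : ∃ b, R b ≠ 0) (hφ : Meromorphic φ)
    (hode : ∀ z, ∀ᶠ y in 𝓝[≠] z, deriv φ y ^ k = R (φ y))
    (hsurj : ∀ b c, R b ≠ 0 → c ^ k = R b →
      ∃ p, AnalyticAt ℂ φ p ∧ φ p = b ∧ deriv φ p = c) :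
    IsGeneralSolution k R (fun z₀ z => φ (z - z₀)) := by
  have hmer (z₀ : ℂ) : Meromorphic fun z => φ (z - z₀) := fun z =>
    (hφ (z - z₀)).comp_analyticAt (f := φ) (g := fun z => z - z₀) (by fun_prop)
  intro U hUo hUc u
  constructor
  · rintro ⟨⟨hu, huode⟩, hconst⟩
    obtain ⟨z, hzU, hz, hne⟩ : ∃ z ∈ U, AnalyticAt ℂ u z ∧ R (u z) ≠ 0 := by
      by_contra! hcon
      obtain ⟨x, hx⟩ := hUc.nonempty
      obtain ⟨z, hz, hzU⟩ := ((hu x hx).eventually_analyticAt.and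
        (nhdsWithin_le_nhds (hUo.mem_nhds hx))).exists
      refine hconst ⟨u z, sameMeromorphicOn_of_eventuallyEq hUc.isPreconnected hu
        (fun y _ => MeromorphicAt.const _ _) hzU (nhdsWithin_le_nhds ?_)⟩
      refine hz.eventually_eq_of_deriv_eventually_eq_zero ?_
      filter_upwards [hz.eventually_analyticAt, hUo.mem_nhds hzU] with y hy hyU
      have := huode y hyU hy
      rw [hcon y hyU hy] at this
      exact eq_zero_of_pow_eq_zero this
    obtain ⟨p, hp, hval, hder⟩ := hsurj (u z) (deriv u z) hne (huode z hzU hz)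
    have hne' : deriv u z ≠ 0 := by
      intro h0
      have := huode z hzU hz
      rw [h0, zero_pow hk] at this
      exact hne this.symm
    refine ⟨z - p, sameMeromorphicOn_of_eventuallyEq hUc.isPreconnected hu
      (fun y _ => hmer _ y) hzU (nhdsWithin_le_nhds ?_)⟩
    refine eventuallyEq_translate_of_deriv_pow_eq hk hz hp hval hder hne' ?_
      (eventually_deriv_pow_eq hR hp (hode p))
    filter_upwards [hz.eventually_analyticAt, hUo.mem_nhds hzU] with y hy hyU
    exact huode y hyU hy
  · rintro ⟨z₀, hsame⟩
    refine ⟨⟨fun z hz => (hmer z₀ z).congr (hsame.eventuallyEq hUo hz).symm,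
      fun z hzU hz => hz.deriv_pow_eq_of_eventually hR ?_⟩, ?_⟩
    · have hev : ∀ᶠ y in 𝓝[≠] z, deriv φ (y - z₀) ^ k = R (φ (y - z₀)) := by
        have ht : Tendsto (fun y => y - z₀) (𝓝[≠] z) (𝓝[≠] (z - z₀)) := by
          refine tendsto_nhdsWithin_iff.2 ⟨?_, ?_⟩
          · exact ((continuous_id.sub continuous_const).tendsto z).mono_left nhdsWithin_le_nhds
          · filter_upwards [self_mem_nhdsWithin] with y hy
            simpa using hy
        exact ht.eventually (hode (z - z₀))
      have heq := hsame.eventuallyEq hUo hzU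
      filter_upwards [hev, heq, eventually_nhdsNE_eventually_nhds_iff.2 heq] with y h₁ h₂ h₃
      have h₅ : u =ᶠ[𝓝 y] fun z => φ (z - z₀) := h₃
      rw [h₅.deriv_eq, deriv_comp_sub_const, h₁, h₂]
    · rintro ⟨c, hc⟩
      obtain ⟨x, hx⟩ := hUc.nonempty
      have h₁ : (fun z => φ (z - z₀)) =ᶠ[𝓝[≠] x] fun _ => c :=
        (hsame.eventuallyEq hUo hx).symm.trans (hc.eventuallyEq hUo hx)
      have h₂ := sameMeromorphicOn_of_eventuallyEq isPreconnected_univ (fun y _ => hmer z₀ y)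
        (fun y _ => MeromorphicAt.const c y) (Set.mem_univ x) h₁
      -- A point with `R b ≠ 0` is attained with nonzero derivative, so `φ` is not constant.
      obtain ⟨b, hb⟩ := hRne
      obtain ⟨d, hd⟩ := IsAlgClosed.exists_pow_nat_eq (R b) (Nat.pos_of_ne_zero hk)
      obtain ⟨p, hp, hval, hder⟩ := hsurj b d hb hd
      have h₃ := h₂.eventuallyEq isOpen_univ (Set.mem_univ (p + z₀))
      have hp' : AnalyticAt ℂ (fun z => φ (z - z₀)) (p + z₀) := by
        refine AnalyticAt.comp (g := φ) (f := fun z => z - z₀) ?_ (by fun_prop)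
        simpa using hp
      have h₄ := hp'.frequently_eq_iff_eventually_eq analyticAt_const |>.1 h₃.frequently
      have h₅ : deriv (fun z => φ (z - z₀)) (p + z₀) = 0 := by
        rw [EventuallyEq.deriv_eq h₄, deriv_const]
      rw [deriv_comp_sub_const, add_sub_cancel_right, hder] at h₅
      rw [h₅, zero_pow hk] at hd
      exact hb hd.symm

/-! ### Weierstrass functions and their cubic -/

namespace PeriodPair

theorem compl_lattice_mem_nhdsNE (P : PeriodPair) (z : ℂ) : (P.lattice : Set ℂ)ᶜ ∈ 𝓝[≠] z := by
  filter_upwards [nhdsWithin_le_nhds (P.compl_lattice_sdiff_singleton_mem_nhds z),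
    self_mem_nhdsWithin] with y hy hyz hmem
  exact hy ⟨hmem, hyz⟩

/-- The Weierstrass `℘` function attains every complex value off its lattice. -/
theorem exists_weierstrassP_eq (P : PeriodPair) (x : ℂ) :
    ∃ z, z ∉ P.lattice ∧ P.weierstrassP z = x := by
  classical
  by_contra! hcon
  -- If `x` is omitted, `1 / (℘ - x)`, extended by `0` over the poles, is entire and periodic, hence
  -- constant, yet it vanishes only on the lattice.
  set f : ℂ → ℂ := fun z => if z ∈ P.lattice then 0 else (P.weierstrassP z - x)⁻¹ with hf
  have hper (z : ℂ) (w : ℂ) (hw : w ∈ P.lattice) : f (z + w) = f z := by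
    have h₁ : z + w ∈ P.lattice ↔ z ∈ P.lattice := P.lattice.add_mem_iff_left hw
    have h₂ : P.weierstrassP (z + w) = P.weierstrassP z := P.weierstrassP_add_coe z ⟨w, hw⟩
    simp only [hf, h₁, h₂]
  have hzero : AnalyticAt ℂ f 0 := by
    have h₁ : AnalyticAt ℂ (P.weierstrassPExcept 0) 0 := P.analyticAt_weierstrassPExcept 0
    have h₂ : AnalyticAt ℂ
        (fun z => z ^ 2 / (1 + z ^ 2 * (P.weierstrassPExcept 0 z - x))) 0 := by
      fun_prop (disch := simp)
    refine h₂.congr ?_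
    filter_upwards [P.compl_lattice_sdiff_singleton_mem_nhds 0] with z hz
    by_cases hz0 : z = 0
    · simp [hf, hz0]
    have hzl : z ∉ P.lattice := fun h => hz ⟨h, hz0⟩
    have h₃ := P.weierstrassPExcept_def 0 z
    simp only [ZeroMemClass.coe_zero] at h₃
    have h₄ : P.weierstrassP z - x ≠ 0 := sub_ne_zero.2 (hcon z hzl)
    have h₅ : 1 + z ^ 2 * (P.weierstrassPExcept 0 z - x) = z ^ 2 * (P.weierstrassP z - x) := by
      rw [h₃]
      field_simp
      ring
    simp only [hf, hzl, if_false, h₅]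
    field_simp
  have hdiff : Differentiable ℂ f := by
    intro z
    by_cases hz : z ∈ P.lattice
    · have h₁ : f = fun y => f (y - z) := by
        funext y
        rw [sub_eq_add_neg, hper y (-z) (neg_mem hz)]
      have h₂ : DifferentiableAt ℂ f (z - z) := by simpa using hzero.differentiableAt
      rw [h₁]
      exact DifferentiableAt.comp (g := f) (f := fun y => y - z) z h₂
        (differentiableAt_fun_id.sub_const z)
    · have h₁ := (P.analyticOnNhd_weierstrassP z hz).differentiableAt
      have h₂ : DifferentiableAt ℂ (fun z => (P.weierstrassP z - x)⁻¹) z :=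
        (h₁.sub_const x).inv (sub_ne_zero.2 (hcon z hz))
      refine h₂.congr_of_eventuallyEq ?_
      filter_upwards [P.isClosed_lattice.isOpen_compl.mem_nhds hz] with y hy
      have hy' : y ∉ P.lattice := hy
      simp only [hf, hy', if_false]
  have hconst := hdiff.apply_eq_apply_of_bounded
    (IsZLattice.isCompact_range_of_periodic P.lattice f hdiff.continuous hper).isBounded
    (P.ω₁ / 2) 0
  have hω := P.ω₁_div_two_notMem_lattice
  simp only [hf, hω, if_false, zero_mem, if_true] at hconst
  exact inv_ne_zero (sub_ne_zero.2 (hcon _ hω)) hconst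

/-- The Weierstrass functions parametrize the affine points of their cubic. -/
theorem exists_weierstrassP_derivWeierstrassP_eq (P : PeriodPair) {x y : ℂ}
    (h : y ^ 2 = 4 * x ^ 3 - P.g₂ * x - P.g₃) :
    ∃ z, z ∉ P.lattice ∧ P.weierstrassP z = x ∧ P.derivWeierstrassP z = y := by
  obtain ⟨z, hz, hx⟩ := P.exists_weierstrassP_eq x
  have := P.derivWeierstrassP_sq z hz
  rw [hx, ← h] at this
  rcases sq_eq_sq_iff_eq_or_eq_neg.1 this with hy | hy
  · exact ⟨z, hz, hx, hy⟩
  · exact ⟨-z, by simpa using hz, by simpa using hx, by simp [hy]⟩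

theorem hasDerivAt_weierstrassP (P : PeriodPair) {z : ℂ} (hz : z ∉ P.lattice) :
    HasDerivAt P.weierstrassP (P.derivWeierstrassP z) z := by
  rw [← P.deriv_weierstrassP]
  exact (P.analyticOnNhd_weierstrassP z hz).differentiableAt.hasDerivAt

theorem hasDerivAt_derivWeierstrassP (P : PeriodPair) {z : ℂ} (hz : z ∉ P.lattice)
    (hz' : P.derivWeierstrassP z ≠ 0) :
    HasDerivAt P.derivWeierstrassP (6 * P.weierstrassP z ^ 2 - P.g₂ / 2) z := by
  have h := (P.analyticOnNhd_derivWeierstrassP z hz).differentiableAt.hasDerivAt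
  have h₁ := P.hasDerivAt_weierstrassP hz
  have h₂ := ((h₁.pow 3).const_mul 4).sub (h₁.const_mul P.g₂) |>.sub_const P.g₃
  have h₃ : (fun y => P.derivWeierstrassP y ^ 2) =ᶠ[𝓝 z]
      fun y => 4 * P.weierstrassP y ^ 3 - P.g₂ * P.weierstrassP y - P.g₃ := by
    filter_upwards [P.isClosed_lattice.isOpen_compl.mem_nhds hz] with y hy
    exact P.derivWeierstrassP_sq y hy
  have h₄ := (h.pow 2).unique (h₂.congr_of_eventuallyEq h₃)
  have h₅ : deriv P.derivWeierstrassP z = 6 * P.weierstrassP z ^ 2 - P.g₂ / 2 := by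
    -- Differentiating the cubic relation gives the formula multiplied by `2 * ℘'`.
    refine mul_left_cancel₀ (mul_ne_zero two_ne_zero hz') ?_
    simp only [Nat.cast_ofNat, Nat.add_one_sub_one, pow_one] at h₄
    linear_combination h₄
  rwa [h₅] at h

/-- A meromorphic function on the plane that does not vanish identically has isolated zeros. -/
theorem _root_.Meromorphic.eventually_ne_zero_of_apply_ne_zero {F : ℂ → ℂ} (hF : Meromorphic F) {p : ℂ}
    (hp : ContinuousAt F p) (hne : F p ≠ 0) (z : ℂ) : ∀ᶠ y in 𝓝[≠] z, F y ≠ 0 := by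
  have h₁ : meromorphicOrderAt F p ≠ ⊤ := (meromorphicOrderAt_ne_top_iff_eventually_ne_zero
    (hF p)).2 (nhdsWithin_le_nhds (hp.eventually_ne hne))
  exact (meromorphicOrderAt_ne_top_iff_eventually_ne_zero (hF z)).1
    (MeromorphicOn.meromorphicOrderAt_ne_top_of_isPreconnected (U := Set.univ)
      (fun x _ => hF x) isPreconnected_univ (Set.mem_univ p) (Set.mem_univ z) h₁)

/-! ### Lattices with prescribed invariants -/

/-- The invariants of a lattice do not both vanish. -/
theorem g₂_ne_zero_or_g₃_ne_zero (P : PeriodPair) : P.g₂ ≠ 0 ∨ P.g₃ ≠ 0 := by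
  by_contra! hcon
  have hz := P.ω₁_div_two_notMem_lattice
  set z := P.ω₁ / 2 with hzdef
  have h₁ : P.derivWeierstrassP z = 0 := by
    have h := P.derivWeierstrassP_add_coe (-z) ⟨P.ω₁, P.ω₁_mem_lattice⟩
    rw [P.derivWeierstrassP_neg, show -z + P.ω₁ = z by rw [hzdef]; ring] at h
    exact self_eq_neg.1 h
  have hsq : ∀ y ∉ P.lattice, P.derivWeierstrassP y ^ 2 = 4 * P.weierstrassP y ^ 3 := by
    intro y hy
    rw [P.derivWeierstrassP_sq y hy, hcon.1, hcon.2]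
    ring
  have h₂ : P.weierstrassP z = 0 := by simpa [h₁] using hsq z hz
  have ha := P.analyticOnNhd_weierstrassP z hz
  -- If `℘'` has order `n` at the half period, `℘` has order `n + 1`, and `℘' ^ 2 = 4 * ℘ ^ 3`
  -- forces the impossible `2 * n = 3 * (n + 1)`.
  have hord := ha.analyticOrderAt_deriv_add_one
  rw [h₂, P.deriv_weierstrassP] at hord
  simp only [sub_zero] at hord
  have hpow : analyticOrderAt (P.derivWeierstrassP ^ 2) z =
      analyticOrderAt ((fun _ => (4 : ℂ)) * P.weierstrassP ^ 3) z := by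
    apply analyticOrderAt_congr
    filter_upwards [P.isClosed_lattice.isOpen_compl.mem_nhds hz] with y hy
    simpa using hsq y hy
  have h4 : analyticOrderAt (fun _ : ℂ => (4 : ℂ)) z = 0 :=
    analyticAt_const.analyticOrderAt_eq_zero.2 (by norm_num)
  rw [analyticOrderAt_pow (P.analyticOnNhd_derivWeierstrassP z hz),
    analyticOrderAt_mul analyticAt_const (ha.pow 3), analyticOrderAt_pow ha, h4] at hpow
  have hfin : analyticOrderAt P.derivWeierstrassP z ≠ ⊤ := by
    intro htop
    have hev := analyticOrderAt_eq_top.1 htop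
    obtain ⟨p, hp, hpx, hpy⟩ := P.exists_weierstrassP_derivWeierstrassP_eq (x := 1) (y := 2)
      (by rw [hcon.1, hcon.2]; norm_num)
    have := P.meromorphic_derivWeierstrassP.eventually_ne_zero_of_apply_ne_zero
      (P.analyticOnNhd_derivWeierstrassP p hp).continuousAt (by rw [hpy]; norm_num) z
    obtain ⟨y, hy, hy'⟩ := (this.and (nhdsWithin_le_nhds hev)).exists
    exact hy hy'
  rw [← hord] at hpow
  obtain ⟨n, hn⟩ := ENat.ne_top_iff_exists.1 hfin
  rw [← hn] at hpow
  norm_cast at hpow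
  simp at hpow
  norm_cast at hpow
  omega

/-- Lattice sums are homogeneous under complex scaling of the lattice. -/
theorem G_eq_of_lattice_scaling {P Q : PeriodPair} {c : ℂ} (hc : c ≠ 0)
    (h : ∀ z, c * z ∈ Q.lattice ↔ z ∈ P.lattice) (n : ℕ) : Q.G n = (c ^ n)⁻¹ * P.G n := by
  let e : P.lattice ≃ Q.lattice :=
    { toFun := fun z => ⟨c * z, (h z).2 z.2⟩
      invFun := fun z => ⟨c⁻¹ * z, (h _).1 (by rw [mul_inv_cancel_left₀ hc]; exact z.2)⟩
      left_inv := fun z => by ext; simp [hc]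
      right_inv := fun z => by ext; simp [hc] }
  rw [G, G, ← e.tsum_eq, ← tsum_mul_left]
  congr 1
  funext z
  simp [e, mul_pow, mul_comm]

/-- The lattice obtained by multiplying both periods by a nonzero complex number. -/
def scale (P : PeriodPair) (c : ℂ) (hc : c ≠ 0) : PeriodPair where
  ω₁ := c * P.ω₁
  ω₂ := c * P.ω₂
  indep := by
    have := P.indep
    rw [LinearIndependent.pair_iff] at this ⊢
    intro s t hst
    refine this s t (mul_left_cancel₀ hc ?_)
    simp only [Complex.real_smul] at hst ⊢
    linear_combination hst

theorem mul_mem_lattice_scale (P : PeriodPair) {c : ℂ} (hc : c ≠ 0) (z : ℂ) :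
    c * z ∈ (P.scale c hc).lattice ↔ z ∈ P.lattice := by
  simp only [mem_lattice, scale]
  refine exists₂_congr fun m n => ?_
  rw [← mul_right_inj' hc (b := (m : ℂ) * P.ω₁ + n * P.ω₂)]
  constructor <;> intro h <;> linear_combination h

theorem G_scale (P : PeriodPair) {c : ℂ} (hc : c ≠ 0) (n : ℕ) :
    (P.scale c hc).G n = (c ^ n)⁻¹ * P.G n :=
  G_eq_of_lattice_scaling hc (P.mul_mem_lattice_scale hc) n

/-- A lattice sum vanishes when the lattice has a symmetry acting nontrivially on it. -/
theorem G_eq_zero_of_symmetry (P : PeriodPair) {c : ℂ} (hc : c ≠ 0)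
    (h : ∀ z, c * z ∈ P.lattice ↔ z ∈ P.lattice) {n : ℕ} (hn : c ^ n ≠ 1) : P.G n = 0 := by
  have := G_eq_of_lattice_scaling hc h n
  by_contra hG
  refine hn (inv_eq_one.1 (mul_right_cancel₀ hG ?_))
  rw [← this, one_mul]

/-- The lattice generated by `1` and a nonreal number. -/
def ofIm (τ : ℂ) (hτ : τ.im ≠ 0) : PeriodPair where
  ω₁ := 1
  ω₂ := τ
  indep := by
    rw [LinearIndependent.pair_iff]
    intro s t hst
    have him := congrArg Complex.im hst
    have hre := congrArg Complex.re hst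
    simp at him hre
    have ht : t = 0 := him.resolve_right hτ
    simp [ht] at hre
    exact ⟨hre, ht⟩

/-- If `τ` is a quadratic unit then multiplication by `τ` preserves the lattice `⟨1, τ⟩`. -/
theorem mul_mem_lattice_ofIm {τ : ℂ} (hτ : τ.im ≠ 0) {a : ℤ} (h : τ ^ 2 = a * τ - 1) (z : ℂ) :
    τ * z ∈ (ofIm τ hτ).lattice ↔ z ∈ (ofIm τ hτ).lattice := by
  have hτ0 : τ ≠ 0 := fun h0 => hτ (by simp [h0])
  simp only [mem_lattice, ofIm]
  constructor
  · rintro ⟨m, n, hmn⟩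
    refine ⟨m * a + n, -m, mul_left_cancel₀ hτ0 ?_⟩
    push_cast
    linear_combination hmn - m * h
  · rintro ⟨m, n, hmn⟩
    refine ⟨-n, m + n * a, ?_⟩
    push_cast
    linear_combination τ * hmn - n * h

theorem exists_g₂_eq_zero_g₃_eq {c : ℂ} (hc : c ≠ 0) :
    ∃ P : PeriodPair, P.g₂ = 0 ∧ P.g₃ = c := by
  set τ : ℂ := ⟨-1 / 2, √3 / 2⟩ with hτdef
  have h3 : (√3 : ℝ) * √3 = 3 := Real.mul_self_sqrt (by norm_num)
  have hτ : τ.im ≠ 0 := by simp [hτdef]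
  have hq : τ ^ 2 = (-1 : ℤ) * τ - 1 := by
    apply Complex.ext
    · simp [hτdef, sq]; nlinarith
    · simp [hτdef, sq]; ring
  have hτ0 : τ ≠ 0 := fun h0 => hτ (by simp [h0])
  set P := ofIm τ hτ
  have hcube : τ ^ 4 = τ := by
    push_cast at hq
    linear_combination (τ ^ 2 - τ) * hq
  have hg2 : P.g₂ = 0 := by
    rw [g₂, P.G_eq_zero_of_symmetry hτ0 (mul_mem_lattice_ofIm hτ hq), mul_zero]
    rw [hcube]
    intro h1
    exact hτ (by simp [h1])
  have hg3 : P.g₃ ≠ 0 := P.g₂_ne_zero_or_g₃_ne_zero.resolve_left (not_not.2 hg2)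
  -- Scaling the lattice by `s` divides `g₃` by `s ^ 6`.
  obtain ⟨s, hs⟩ := IsAlgClosed.exists_pow_nat_eq (P.g₃ / c) (n := 6) (by norm_num)
  have hs0 : s ≠ 0 := by
    rintro rfl
    exact div_ne_zero hg3 hc (by rw [← hs]; simp)
  refine ⟨P.scale s hs0, ?_, ?_⟩
  · rw [g₂, G_scale, mul_left_comm, ← g₂, hg2, mul_zero]
  · rw [g₃, G_scale, mul_left_comm, ← g₃, hs]
    field_simp

theorem exists_g₂_eq_g₃_eq_zero {c : ℂ} (hc : c ≠ 0) :
    ∃ P : PeriodPair, P.g₂ = c ∧ P.g₃ = 0 := by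
  have hτ : Complex.I.im ≠ 0 := by simp
  set P := ofIm Complex.I hτ
  have hg3 : P.g₃ = 0 := by
    rw [g₃, P.G_eq_zero_of_symmetry Complex.I_ne_zero
      (mul_mem_lattice_ofIm hτ (a := 0) (by simp)), mul_zero]
    rw [show Complex.I ^ 6 = (Complex.I ^ 2) ^ 3 by ring, Complex.I_sq]
    norm_num
  have hg2 : P.g₂ ≠ 0 := P.g₂_ne_zero_or_g₃_ne_zero.resolve_right (not_not.2 hg3)
  obtain ⟨s, hs⟩ := IsAlgClosed.exists_pow_nat_eq (P.g₂ / c) (n := 4) (by norm_num)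
  have hs0 : s ≠ 0 := by
    rintro rfl
    exact div_ne_zero hg2 hc (by rw [← hs]; simp)
  refine ⟨P.scale s hs0, ?_, ?_⟩
  · rw [g₂, G_scale, mul_left_comm, ← g₂, hs]
    field_simp
  · rw [g₃, G_scale, mul_left_comm, ← g₃, hg3, mul_zero]

end PeriodPair

/-! ### The two binomial equations -/

/-- Since `g₂ = 0`, `u'` is a multiple of `℘ ^ 2 / ℘' ^ 2`, and `℘ ^ 3` is a polynomial in `℘' ^ 2`;
cubing therefore eliminates `℘`. -/
theorem isGeneralSolution_inv_derivWeierstrassP {L : ℂ} (hL : L ≠ 0) (P : PeriodPair)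
    (h₂ : P.g₂ = 0) (h₃ : P.g₃ = -(4 * L ^ 6) / 729) :
    IsGeneralSolution 3 (fun u => L ^ 3 * u ^ 2 * (u - 1) ^ 2 * (u + 1) ^ 2)
      (fun z₀ z => -(2 * L ^ 3) / (27 * P.derivWeierstrassP (z - z₀))) := by
  have hsq : ∀ z ∉ P.lattice, P.derivWeierstrassP z ^ 2 =
      4 * P.weierstrassP z ^ 3 + 4 * L ^ 6 / 729 := by
    intro z hz
    rw [P.derivWeierstrassP_sq z hz, h₂, h₃]
    ring
  have hder {z : ℂ} (hz : z ∉ P.lattice) (hz' : P.derivWeierstrassP z ≠ 0) :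
      deriv (fun z => -(2 * L ^ 3) / (27 * P.derivWeierstrassP z)) z =
        4 * L ^ 3 * P.weierstrassP z ^ 2 / (9 * P.derivWeierstrassP z ^ 2) := by
    have h := (P.hasDerivAt_derivWeierstrassP hz hz').const_mul 27
    have h' := ((hasDerivAt_const z (-(2 * L ^ 3))).div h (by simpa using hz')).deriv
    refine h'.trans ?_
    rw [h₂]
    field_simp
    ring
  refine isGeneralSolution_of_transitive (by norm_num)
    (φ := fun z => -(2 * L ^ 3) / (27 * P.derivWeierstrassP z)) (by fun_prop)
    ⟨2, by norm_num [hL]⟩ ?_ ?_ ?_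
  · have := P.meromorphic_derivWeierstrassP
    fun_prop
  · intro z
    obtain ⟨p, hp, -, hpy⟩ := P.exists_weierstrassP_derivWeierstrassP_eq
      (x := 0) (y := 2 * L ^ 3 / 27) (by rw [h₂, h₃]; ring)
    filter_upwards [P.compl_lattice_mem_nhdsNE z,
      P.meromorphic_derivWeierstrassP.eventually_ne_zero_of_apply_ne_zero
        (P.analyticOnNhd_derivWeierstrassP p hp).continuousAt (by simp [hpy, hL]) z] with y hy hy'
    rw [hder hy hy']
    have hx : P.weierstrassP y ^ 3 = P.derivWeierstrassP y ^ 2 / 4 - L ^ 6 / 729 := by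
      rw [hsq y hy]
      ring
    have hx6 : (P.weierstrassP y ^ 2) ^ 3 =
        (P.derivWeierstrassP y ^ 2 / 4 - L ^ 6 / 729) ^ 2 := by
      rw [← hx]
      ring
    rw [div_pow, mul_pow _ (P.weierstrassP y ^ 2), hx6]
    field_simp
    ring
  · intro b d hb hd
    have hb0 : b ≠ 0 := by
      rintro rfl
      simp at hb
    have hd0 : d ≠ 0 := by
      rintro rfl
      exact hb (by rw [← hd]; norm_num)
    -- The value forces `y = -2 * L ^ 3 / (27 * b)`; the derivative then fixes `x ^ 2` and the cubic
    -- fixes `x ^ 3`. Their quotient is `x`.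
    set x := L ^ 3 * (1 - b ^ 2) / (9 * d) with hx
    have hx2 : x ^ 2 = L ^ 3 * d / (81 * b ^ 2) := by
      rw [hx]
      field_simp
      linear_combination -81 * hd
    have hcube : x ^ 3 = L ^ 6 * (1 - b ^ 2) / (729 * b ^ 2) := by
      rw [pow_succ, hx2, hx]
      field_simp
      ring
    obtain ⟨p, hp, hpx, hpy⟩ := P.exists_weierstrassP_derivWeierstrassP_eq
      (x := x) (y := -(2 * L ^ 3) / (27 * b)) (by
        rw [h₂, h₃, hcube]
        field_simp
        ring)
    have hy0 : P.derivWeierstrassP p ≠ 0 := by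
      rw [hpy]
      simp [hL, hb0]
    refine ⟨p, ?_, ?_, ?_⟩
    · have := P.analyticOnNhd_derivWeierstrassP p hp
      fun_prop (disch := simpa using hy0)
    · simp only [hpy]
      field_simp
    · rw [hder hp hy0, hpx, hpy, hx2]
      field_simp
      norm_num

theorem isGeneralSolution_inv_weierstrassP_sq {L : ℂ} (hL : L ≠ 0) (P : PeriodPair)
    (h₂ : P.g₂ = -L ^ 4 / 16) (h₃ : P.g₃ = 0) :
    IsGeneralSolution 4 (fun u => L ^ 4 * u ^ 2 * (u - 1) ^ 3 * (u + 1) ^ 3)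
      (fun z₀ z => 1 + L ^ 4 / (32 * (P.weierstrassP (z - z₀) ^ 2 - L ^ 4 / 64))) := by
  -- In terms of `a`, the solution is `(℘ ^ 2 + a) / (℘ ^ 2 - a)` and the cubic is `y ^ 2 = 4 * x *
  -- (x ^ 2 + a)`.
  obtain ⟨a, ha⟩ : ∃ a : ℂ, L ^ 4 = 64 * a := ⟨L ^ 4 / 64, by ring⟩
  have ha0 : a ≠ 0 := by
    rintro rfl
    exact pow_ne_zero 4 hL (by rw [ha, mul_zero])
  have hLa : L ^ 4 / 64 = a := by
    rw [ha]
    ring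
  have h₂' : P.g₂ = -4 * a := by
    rw [h₂, ha]
    ring
  rw [hLa, ha]
  have hsq : ∀ z ∉ P.lattice, P.derivWeierstrassP z ^ 2 =
      4 * P.weierstrassP z * (P.weierstrassP z ^ 2 + a) := by
    intro z hz
    rw [P.derivWeierstrassP_sq z hz, h₂', h₃]
    ring
  have hder {z : ℂ} (hz : z ∉ P.lattice) (hz' : P.weierstrassP z ^ 2 - a ≠ 0) :
      deriv (fun z => 1 + 64 * a / (32 * (P.weierstrassP z ^ 2 - a))) z =
        -(4 * a * P.weierstrassP z * P.derivWeierstrassP z) /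
          (P.weierstrassP z ^ 2 - a) ^ 2 := by
    have h := (((P.hasDerivAt_weierstrassP hz).pow 2).sub_const a).const_mul 32
    have h' := (((hasDerivAt_const z (64 * a)).div h (by simpa using hz')).const_add 1).deriv
    refine h'.trans ?_
    simp only [Pi.pow_apply]
    field_simp
    ring
  refine isGeneralSolution_of_transitive (by norm_num)
    (φ := fun z => 1 + 64 * a / (32 * (P.weierstrassP z ^ 2 - a))) (by fun_prop)
    ⟨2, by norm_num [ha0]⟩ ?_ ?_ ?_
  · have := P.meromorphic_weierstrassP
    fun_prop
  · intro z
    have hmer : Meromorphic fun z => P.weierstrassP z ^ 2 - a := by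
      have := P.meromorphic_weierstrassP
      fun_prop
    obtain ⟨p, hp, hpx⟩ := P.exists_weierstrassP_eq 0
    have hcont := (P.analyticOnNhd_weierstrassP p hp).continuousAt
    filter_upwards [P.compl_lattice_mem_nhdsNE z,
      hmer.eventually_ne_zero_of_apply_ne_zero (p := p) (by fun_prop) (by simp [hpx, ha0]) z]
      with y hy hy'
    rw [hder hy hy']
    have hy4 : P.derivWeierstrassP y ^ 4 =
        (4 * P.weierstrassP y * (P.weierstrassP y ^ 2 + a)) ^ 2 := by
      rw [← hsq y hy]
      ring
    have hu : 1 + 64 * a / (32 * (P.weierstrassP y ^ 2 - a)) =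
        (P.weierstrassP y ^ 2 + a) / (P.weierstrassP y ^ 2 - a) := by
      field_simp
      ring
    rw [hu, div_pow, neg_pow, mul_pow _ (P.derivWeierstrassP y), hy4]
    field_simp
    ring
  · intro b d hb hd
    have hb0 : b ≠ 0 := by
      rintro rfl
      simp at hb
    have hb1 : b - 1 ≠ 0 := fun h => hb (by simp [h])
    have hb2 : b + 1 ≠ 0 := fun h => hb (by simp [h])
    have hd0 : d ≠ 0 := by
      rintro rfl
      exact hb (by rw [← hd]; norm_num)
    -- The value fixes `x ^ 2`. Squaring the derivative formula and replacing `y ^ 2` by the cubic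
    -- leaves an equation linear in `x`; the derivative itself then gives `y`.
    set x := d ^ 2 / (8 * b * (b + 1) * (b - 1) ^ 2) with hx
    have hx0 : x ≠ 0 := by
      rw [hx]
      exact div_ne_zero (pow_ne_zero 2 hd0) (by simp [hb0, hb1, hb2])
    have hx2 : x ^ 2 = a * (b + 1) / (b - 1) := by
      rw [hx]
      field_simp
      linear_combination hd
    have hxa : x ^ 2 - a = 2 * a / (b - 1) := by
      rw [hx2]
      field_simp
      ring
    have hxa' : x ^ 2 + a = 2 * a * b / (b - 1) := by
      rw [hx2]
      field_simp
      ring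
    obtain ⟨p, hp, hpx, hpy⟩ := P.exists_weierstrassP_derivWeierstrassP_eq
      (x := x) (y := -(d * a) / ((b - 1) ^ 2 * x)) (by
        have h : 4 * x ^ 3 - P.g₂ * x - P.g₃ = 4 * x ^ 2 * (x ^ 2 + a) / x := by
          rw [h₂', h₃]
          field_simp
          ring
        rw [h, div_pow, mul_pow, hxa', hx2, hx]
        field_simp
        linear_combination hd)
    have hne : P.weierstrassP p ^ 2 - a ≠ 0 := by
      rw [hpx, hxa]
      simp [ha0, hb1]
    refine ⟨p, ?_, ?_, ?_⟩
    · have := P.analyticOnNhd_weierstrassP p hp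
      fun_prop (disch := simpa using hne)
    · simp only [hpx, hxa]
      field_simp
      ring
    · rw [hder hp hne, hpx, hpy, hxa]
      field_simp
      ring

theorem mainTheorem2 (L : ℂ) (hL : L ≠ 0) :
    ((∃ P : PeriodPair, P.g₂ = 0 ∧ P.g₃ = -(4 * L ^ 6) / 729) ∧
      ∀ P : PeriodPair, P.g₂ = 0 → P.g₃ = -(4 * L ^ 6) / 729 →
        IsGeneralSolution 3 (fun u => L ^ 3 * u ^ 2 * (u - 1) ^ 2 * (u + 1) ^ 2)
          (fun z₀ z => -(2 * L ^ 3) / (27 * P.derivWeierstrassP (z - z₀)))) ∧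
    ((∃ P : PeriodPair, P.g₂ = -L ^ 4 / 16 ∧ P.g₃ = 0) ∧
      ∀ P : PeriodPair, P.g₂ = -L ^ 4 / 16 → P.g₃ = 0 →
        IsGeneralSolution 4 (fun u => L ^ 4 * u ^ 2 * (u - 1) ^ 3 * (u + 1) ^ 3)
          (fun z₀ z => 1 + L ^ 4 / (32 * (P.weierstrassP (z - z₀) ^ 2 - L ^ 4 / 64)))) :=
  ⟨⟨PeriodPair.exists_g₂_eq_zero_g₃_eq (by simp [hL]),
    isGeneralSolution_inv_derivWeierstrassP hL⟩,
   ⟨PeriodPair.exists_g₂_eq_g₃_eq_zero (by simp [hL]),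
    isGeneralSolution_inv_weierstrassP_sq hL⟩⟩
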